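/- Let $c,d\in\mathbb{N}$ with $d\geq 1$, let $H,Q_1,\dots,Q_c$ be $d\times d$ Hermitian matrices, and let $q\in\mathbb{R}^c$. Let $\mathcal{M}_d$ be the set of Hermitian $d\times d$ matrices $M$ with $0\le M\le I$, and assume that there is at least one $M\in\mathcal{M}_d$ with $\operatorname{Tr}[Q_iM]=q_i$ for all $i$. Define $$E(\mathcal{Q},q)=\min_{M\in\mathcal{M}_d}\left\{\operatorname{Tr}[HM]:\operatorname{Tr}[Q_iM]=q_i\ \forall i\right\},$$ and, for $T>0$, $$F_T(\mathcal{Q},q)=\min_{M\in\mathcal{M}_d}\left\{\operatorname{Tr}[HM]-T\,S_{\mathrm{FD}}(M):\operatorname{Tr}[Q_iM]=q_i\ \forall i\right\},$$ where $S_{\mathrm{FD}}(M)=-\operatorname{Tr}[M\ln M]-\operatorname{Tr}[(I-M)\ln(I-M)]$. For $\mu\in\mathbb{R}^c$, write $\mu\cdot q=\sum_i\mu_iq_i$ and $\mu\cdot Q=\sum_i\mu_iQ_i$, and let $$f_T(\mu)=\mu\cdot q-T\operatorname{Tr}\left[\ln\left(e^{-(H-\mu\cdot Q)/T}+I\right)\right],\qquad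 M_T(\mu)=\left(e^{(H-\mu\cdot Q)/T}+I\right)^{-1},$$ $$\tilde f_T(\mu)=\mu\cdot q+\operatorname{Tr}\left[(H-\mu\cdot Q)M_T(\mu)\right].$$ Fix $\varepsilon,T>0$, and let $\mu_T^\star\in\mathbb{R}^c$ be a parameter vector that is optimal for $F_T(\mathcal{Q},q)$, i.e., a maximizer of the dual objective $f_T$ over $\mathbb{R}^c$. If $T\le\frac{\varepsilon}{d\ln 2}$, then $F_T(\mathcal{Q},q)=f_T(\mu_T^\star)$ and $$\left|\tilde f_T(\mu_T^\star)-E(\mathcal{Q},q)\right|\le\varepsilon.$$ -/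

import Mathlib

noncomputable section

namespace FermiDirac

open scoped ComplexOrder

/-- Measurement operators on `ℂ^d`: Hermitian matrices `M` with `0 ≤ M ≤ I`. -/
def measurementOps (d : ℕ) : Set (Matrix (Fin d) (Fin d) ℂ) :=
  {M | M.PosSemidef ∧ (1 - M).PosSemidef}

/-- Measurement operators satisfying all the constraints `Tr[Q_i M] = q_i`. -/
def feasibleOps {c d : ℕ} (Q : Fin c → Matrix (Fin d) (Fin d) ℂ) (q : Fin c → ℝ) :
    Set (Matrix (Fin d) (Fin d) ℂ) :=
  {M | M ∈ measurementOps d ∧ ∀ i, (Q i * M).trace = (q i : ℂ)}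

/-- The energy `E(𝒬, q)`, the minimum of `Tr[H M]` over the feasible measurement operators.
For Hermitian `H`, `Tr[H M]` is real. The feasible set is compact, so whenever it is nonempty
this infimum is a minimum. -/
def energy {c d : ℕ} (H : Matrix (Fin d) (Fin d) ℂ) (Q : Fin c → Matrix (Fin d) (Fin d) ℂ)
    (q : Fin c → ℝ) : ℝ :=
  sInf ((fun M => (H * M).trace.re) '' feasibleOps Q q)

/-- Von Neumann entropy `S(M) = -Tr[M ln M]`, where `ln M` is defined by the functional calculus
of the Hermitian matrix `M`. Since `Real.log 0 = 0`, the usual convention `0 ln 0 = 0` holds. -/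
def vonNeumannEntropy {d : ℕ} (M : Matrix (Fin d) (Fin d) ℂ) : ℝ :=
  -(M * cfc Real.log M).trace.re

/-- Fermi--Dirac entropy `S_FD(M) = S(M) + S(I - M)`. -/
def fdEntropy {d : ℕ} (M : Matrix (Fin d) (Fin d) ℂ) : ℝ :=
  vonNeumannEntropy M + vonNeumannEntropy (1 - M)

/-- The free energy `F_T(𝒬, q)`, the minimum of `Tr[H M] - T S_FD(M)` over the feasible
measurement operators (again attained whenever the feasible set is nonempty). -/
def freeEnergy {c d : ℕ} (T : ℝ) (H : Matrix (Fin d) (Fin d) ℂ)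
    (Q : Fin c → Matrix (Fin d) (Fin d) ℂ) (q : Fin c → ℝ) : ℝ :=
  sInf ((fun M => (H * M).trace.re - T * fdEntropy M) '' feasibleOps Q q)

/-- The matrix `H - μ · Q`, where `μ · Q = ∑ i, μ_i Q_i`. -/
def shiftedHam {c d : ℕ} (H : Matrix (Fin d) (Fin d) ℂ)
    (Q : Fin c → Matrix (Fin d) (Fin d) ℂ) (μ : Fin c → ℝ) : Matrix (Fin d) (Fin d) ℂ :=
  H - ∑ i, μ i • Q i

/-- The dual objective `f_T(μ) = μ · q - T Tr[ln(exp(-(H - μ · Q) / T) + I)]`. -/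
def dualObjective {c d : ℕ} (T : ℝ) (H : Matrix (Fin d) (Fin d) ℂ)
    (Q : Fin c → Matrix (Fin d) (Fin d) ℂ) (q μ : Fin c → ℝ) : ℝ :=
  ∑ i, μ i * q i -
    T * (cfc Real.log (NormedSpace.exp ((-(1 / T)) • shiftedHam H Q μ) + 1)).trace.re

/-- The Fermi--Dirac thermal measurement operator `M_T(μ) = (exp((H - μ · Q) / T) + I)⁻¹`. -/
def thermalOp {c d : ℕ} (T : ℝ) (H : Matrix (Fin d) (Fin d) ℂ)
    (Q : Fin c → Matrix (Fin d) (Fin d) ℂ) (μ : Fin c → ℝ) : Matrix (Fin d) (Fin d) ℂ :=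
  (NormedSpace.exp ((1 / T) • shiftedHam H Q μ) + 1)⁻¹

/-- The entropy-free objective `f̃_T(μ) = μ · q + Tr[(H - μ · Q) M_T(μ)]`. -/
def entropyFreeObjective {c d : ℕ} (T : ℝ) (H : Matrix (Fin d) (Fin d) ℂ)
    (Q : Fin c → Matrix (Fin d) (Fin d) ℂ) (q μ : Fin c → ℝ) : ℝ :=
  ∑ i, μ i * q i + (shiftedHam H Q μ * thermalOp T H Q μ).trace.re

end FermiDirac

end

namespace FermiDirac

open scoped ComplexOrder Topology
open Filter Matrix

variable {c d : ℕ}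

/-! ### Traces of functions of Hermitian matrices, and bounds on the Fermi–Dirac entropy. -/

section FunctionalCalculus

/-! By the Gibbs variational principle, for Hermitian `A` the minimum of Tr[AM] - T S_FD(M) over 0 ≤
M ≤ I is -T Tr ln(e^{-A/T} + I), attained at (e^{A/T} + I)⁻¹ (`neg_logPartition_le`,
`trace_mul_fermiOp_sub`). Taking A = H - μ·Q gives weak duality, `dualObjective_le`. At a dual
maximizer, stationarity says exactly that M_T(μ) meets the constraints
(`thermalOp_mem_feasibleOps`). Hence there is no duality gap, and the entropy-free objective equals
Tr[H M_T(μ)]. Since 0 ≤ S_FD ≤ d ln 2, both E and Tr[H M_T(μ)] = f_T(μ) + T S_FD(M_T(μ)) lie in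
[f_T(μ), f_T(μ) + ε]. -/

lemma continuousOn_spectrum (f : ℝ → ℝ) (A : Matrix (Fin d) (Fin d) ℂ) :
    ContinuousOn f (spectrum ℝ A) :=
  (Matrix.finite_real_spectrum (A := A)).continuousOn f

lemma continuousOn_image_spectrum (f g : ℝ → ℝ) (A : Matrix (Fin d) (Fin d) ℂ) :
    ContinuousOn f (g '' spectrum ℝ A) :=
  ((Matrix.finite_real_spectrum (A := A)).image g).continuousOn f

/-- The squared overlaps of two eigenbases express every trace of a product of functions of two
Hermitian matrices. -/
lemma exists_overlap_trace_cfc_mul_cfc {A M : Matrix (Fin d) (Fin d) ℂ}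
    (hA : A.IsHermitian) (hM : M.IsHermitian) :
    ∃ P : Fin d → Fin d → ℝ, (∀ i j, 0 ≤ P i j) ∧ ∀ f g : ℝ → ℝ,
      (cfc f A * cfc g M).trace.re =
        ∑ i, ∑ j, P i j * (f (hA.eigenvalues i) * g (hM.eigenvalues j)) := by
  set U : Matrix (Fin d) (Fin d) ℂ := hA.eigenvectorUnitary.1 with hU
  set V : Matrix (Fin d) (Fin d) ℂ := hM.eigenvectorUnitary.1 with hV
  -- The weights do not depend on `f` and `g`, so traces of different functions can later be
  -- compared term by term.
  refine ⟨fun i j => Complex.normSq ((star U * V) i j), fun i j => Complex.normSq_nonneg _,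
    fun f g => ?_⟩
  set W := star U * V with hW
  have hstarW : star W = star V * U := by rw [hW, star_mul, star_star]
  have key : (cfc f A * cfc g M).trace =
      (diagonal (fun i => (f (hA.eigenvalues i) : ℂ)) * W *
        (diagonal (fun i => (g (hM.eigenvalues i) : ℂ)) * star W)).trace := by
    rw [hA.cfc_eq f, hM.cfc_eq g, IsHermitian.cfc, IsHermitian.cfc,
      Unitary.conjStarAlgAut_apply, Unitary.conjStarAlgAut_apply, hstarW, hW]
    simp only [mul_assoc]
    rw [← hU, ← hV, Matrix.trace_mul_comm]
    simp only [mul_assoc]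
    rfl
  rw [key, Matrix.trace, Complex.re_sum]
  refine Finset.sum_congr rfl fun i _ => ?_
  rw [Matrix.diag_apply, Matrix.mul_apply, Complex.re_sum]
  refine Finset.sum_congr rfl fun j _ => ?_
  rw [Matrix.diagonal_mul, Matrix.diagonal_mul, Matrix.star_apply]
  have : (f (hA.eigenvalues i) : ℂ) * W i j * ((g (hM.eigenvalues j) : ℂ) * star (W i j)) =
      ((Complex.normSq (W i j) * (f (hA.eigenvalues i) * g (hM.eigenvalues j)) : ℝ) : ℂ) := by
    push_cast
    rw [Complex.normSq_eq_conj_mul_self, Complex.star_def]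
    ring
  rw [this, Complex.ofReal_re]

lemma trace_cfc_mono {A : Matrix (Fin d) (Fin d) ℂ} (hA : A.IsHermitian) {f g : ℝ → ℝ}
    (h : ∀ x ∈ spectrum ℝ A, f x ≤ g x) : (cfc f A).trace.re ≤ (cfc g A).trace.re := by
  -- Pairing with the identity matrix turns a single trace into a nonnegatively weighted sum over
  -- eigenvalues.
  obtain ⟨P, hP, key⟩ := exists_overlap_trace_cfc_mul_cfc (isHermitian_one (n := Fin d)) hA
  have e (f : ℝ → ℝ) := key (fun _ => 1) f
  have h1 : cfc (fun _ : ℝ => (1 : ℝ)) (1 : Matrix (Fin d) (Fin d) ℂ) = 1 :=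
    cfc_const_one ℝ _ isHermitian_one.isSelfAdjoint
  simp only [h1, one_mul] at e
  rw [e f, e g]
  exact Finset.sum_le_sum fun i _ => Finset.sum_le_sum fun j _ =>
    mul_le_mul_of_nonneg_left (h _ (hA.eigenvalues_mem_spectrum_real j)) (hP i j)

lemma exp_eq_cfc {A : Matrix (Fin d) (Fin d) ℂ} (hA : A.IsHermitian) :
    NormedSpace.exp A = cfc Real.exp A := by
  have hexp : NormedSpace.exp (diagonal (RCLike.ofReal ∘ hA.eigenvalues : Fin d → ℂ)) =
      diagonal (RCLike.ofReal ∘ Real.exp ∘ hA.eigenvalues) := by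
    rw [Matrix.exp_diagonal]
    congr 1
    funext i
    rw [Pi.coe_exp, ← Complex.exp_eq_exp_ℂ]
    exact (Complex.ofReal_exp _).symm
  rw [hA.cfc_eq, IsHermitian.cfc, Unitary.conjStarAlgAut_apply, ← hexp]
  conv_lhs => rw [hA.spectral_theorem, Unitary.conjStarAlgAut_apply]
  exact Matrix.exp_units_conj (Unitary.toUnits hA.eigenvectorUnitary) _

lemma exp_smul_eq_cfc {A : Matrix (Fin d) (Fin d) ℂ} (hA : A.IsHermitian) (r : ℝ) :
    NormedSpace.exp (r • A) = cfc (fun x => Real.exp (r * x)) A := by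
  have hr : IsSelfAdjoint (r • A) := (IsSelfAdjoint.all r).smul hA.isSelfAdjoint
  rw [exp_eq_cfc hr, ← cfc_comp_const_mul r Real.exp A (continuousOn_image_spectrum _ _ _)
    hA.isSelfAdjoint]

lemma cfc_one_sub {M : Matrix (Fin d) (Fin d) ℂ} (hM : M.IsHermitian) :
    cfc (fun x : ℝ => 1 - x) M = 1 - M := by
  rw [cfc_sub (fun _ => 1) (fun x => x) M, cfc_const_one ℝ M hM.isSelfAdjoint,
    cfc_id' ℝ M hM.isSelfAdjoint]

lemma posSemidef_cfc {A : Matrix (Fin d) (Fin d) ℂ} (hA : A.IsHermitian) {f : ℝ → ℝ}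
    (hf : ∀ x, 0 ≤ f x) : (cfc f A).PosSemidef := by
  have hf' : (cfc f A).IsHermitian := cfc_predicate f A
  refine hf'.posSemidef_iff_eigenvalues_nonneg.2 fun i => ?_
  have h := hf'.eigenvalues_mem_spectrum_real i
  rw [cfc_map_spectrum f A hA.isSelfAdjoint (continuousOn_spectrum f A)] at h
  obtain ⟨x, -, hx⟩ := h
  exact (hf x).trans_eq hx

lemma spectrum_subset_Icc {M : Matrix (Fin d) (Fin d) ℂ} (hM : M ∈ measurementOps d) :
    spectrum ℝ M ⊆ Set.Icc 0 1 := by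
  intro x hx
  have key : ∀ {N : Matrix (Fin d) (Fin d) ℂ}, N.PosSemidef → ∀ y ∈ spectrum ℝ N, 0 ≤ y := by
    intro N hN y hy
    rw [hN.isHermitian.spectrum_real_eq_range_eigenvalues] at hy
    obtain ⟨i, rfl⟩ := hy
    exact hN.eigenvalues_nonneg i
  refine ⟨key hM.1 x hx, sub_nonneg.1 (key hM.2 _ ?_)⟩
  rw [← cfc_one_sub hM.1.isHermitian, cfc_map_spectrum _ M hM.1.isHermitian.isSelfAdjoint
    (continuousOn_spectrum _ _)]
  exact ⟨x, hx, rfl⟩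

lemma fdEntropy_eq_trace_cfc {M : Matrix (Fin d) (Fin d) ℂ} (hM : M.IsHermitian) :
    fdEntropy M = (cfc Real.binEntropy M).trace.re := by
  have hsa := hM.isSelfAdjoint
  have h1 : M * cfc Real.log M = cfc (fun x => x * Real.log x) M := by
    rw [cfc_mul (fun x => x) Real.log M (continuousOn_spectrum _ _) (continuousOn_spectrum _ _),
      cfc_id' ℝ M hsa]
  have h2 : (1 - M) * cfc Real.log (1 - M) = cfc (fun x => (1 - x) * Real.log (1 - x)) M := by
    rw [cfc_mul (fun x => 1 - x) (fun x => Real.log (1 - x)) M (continuousOn_spectrum _ _)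
      (continuousOn_spectrum _ _), cfc_comp' Real.log (fun x => 1 - x) M
      (continuousOn_image_spectrum _ _ _) (continuousOn_spectrum _ _) hsa, cfc_one_sub hM]
  have h3 : Real.binEntropy = fun x => -(x * Real.log x + (1 - x) * Real.log (1 - x)) := by
    funext x
    rw [Real.binEntropy_eq_negMulLog_add_negMulLog_one_sub, Real.negMulLog, Real.negMulLog]
    ring
  rw [fdEntropy, vonNeumannEntropy, vonNeumannEntropy, h1, h2, h3, cfc_neg,
    cfc_add M (fun x => x * Real.log x) _ (continuousOn_spectrum _ _) (continuousOn_spectrum _ _),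
    trace_neg, trace_add, Complex.neg_re, Complex.add_re]
  ring

lemma fdEntropy_nonneg {M : Matrix (Fin d) (Fin d) ℂ} (hM : M ∈ measurementOps d) :
    0 ≤ fdEntropy M := by
  rw [fdEntropy_eq_trace_cfc hM.1.isHermitian]
  have := trace_cfc_mono hM.1.isHermitian (f := fun _ => 0) (g := Real.binEntropy) fun x hx =>
    Real.binEntropy_nonneg (spectrum_subset_Icc hM hx).1 (spectrum_subset_Icc hM hx).2
  simpa [cfc_const_zero] using this

lemma fdEntropy_le {M : Matrix (Fin d) (Fin d) ℂ} (hM' : M ∈ measurementOps d) :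
    fdEntropy M ≤ d * Real.log 2 := by
  have hM := hM'.1.isHermitian
  rw [fdEntropy_eq_trace_cfc hM]
  have := trace_cfc_mono hM (f := Real.binEntropy) (g := fun _ => Real.log 2) fun x _ =>
    Real.binEntropy_le_log_two
  rw [cfc_const _ M hM.isSelfAdjoint, Algebra.algebraMap_eq_smul_one, trace_smul, trace_one] at this
  simpa [mul_comm, ← Complex.ofReal_ofNat, Complex.log_ofReal_re] using this

/-- Feasibility is an equation in ℂ, while the dual argument controls only real parts. -/
lemma trace_mul_ofReal_re {A B : Matrix (Fin d) (Fin d) ℂ} (hA : A.IsHermitian)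
    (hB : B.IsHermitian) : ((A * B).trace.re : ℂ) = (A * B).trace := by
  rw [← Complex.conj_eq_iff_re, ← Complex.star_def, ← trace_conjTranspose, conjTranspose_mul,
    hA.eq, hB.eq, trace_mul_comm]

end FunctionalCalculus

/-! ### The Gibbs variational principle for the Fermi–Dirac entropy. -/

section Gibbs

/-- This is nonnegativity of the relative entropy of (m, 1 - m) with respect to (p, 1 - p), where p
= e^{-x}/(e^{-x} + 1). Each half is ln y ≤ y - 1, and the linear terms cancel on summing. -/
lemma binEntropy_le_mul_add_log (x : ℝ) {m : ℝ} (hm0 : 0 ≤ m) (hm1 : m ≤ 1) :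
    Real.binEntropy m ≤ x * m + Real.log (Real.exp (-x) + 1) := by
  have gibbs : ∀ {a p : ℝ}, 0 ≤ a → 0 < p → Real.negMulLog a ≤ p - a - a * Real.log p := by
    intro a p ha hp
    rcases ha.eq_or_lt with rfl | ha
    · simpa using hp.le
    · have h := mul_le_mul_of_nonneg_left (Real.log_le_sub_one_of_pos (div_pos hp ha)) ha.le
      rw [Real.log_div hp.ne' ha.ne', mul_sub, mul_sub, mul_div_cancel₀ _ ha.ne'] at h
      rw [Real.negMulLog]
      linarith
  have hpos : 0 < Real.exp (-x) + 1 := by positivity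
  have h1 := gibbs hm0 (div_pos (Real.exp_pos (-x)) hpos)
  have h2 := gibbs (sub_nonneg.2 hm1) (div_pos one_pos hpos)
  rw [Real.log_div (Real.exp_pos _).ne' hpos.ne', Real.log_exp] at h1
  rw [Real.log_div one_ne_zero hpos.ne', Real.log_one] at h2
  have h3 : Real.exp (-x) / (Real.exp (-x) + 1) + 1 / (Real.exp (-x) + 1) = 1 := by
    rw [← add_div, div_self hpos.ne']
  rw [Real.binEntropy_eq_negMulLog_add_negMulLog_one_sub]
  linarith

lemma binEntropy_fermi (x : ℝ) :
    Real.binEntropy (Real.exp x + 1)⁻¹ =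
      x * (Real.exp x + 1)⁻¹ + Real.log (Real.exp (-x) + 1) := by
  have hpos : 0 < Real.exp x + 1 := by positivity
  have h1 : Real.exp (-x) + 1 = (Real.exp x + 1) / Real.exp x := by
    rw [Real.exp_neg]; field_simp; ring
  have h2 : 1 - (Real.exp x + 1)⁻¹ = Real.exp x / (Real.exp x + 1) := by field_simp; ring
  rw [Real.binEntropy, h1, h2, inv_inv, inv_div, Real.log_div hpos.ne' (Real.exp_pos _).ne',
    Real.log_exp]
  have h3 : Real.exp x / (Real.exp x + 1) = 1 - (Real.exp x + 1)⁻¹ := h2.symm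
  rw [h3]
  ring

/-- The logarithm of the grand-canonical partition function, `Tr[ln(exp(-A / T) + I)]`. -/
noncomputable def logPartition (T : ℝ) (A : Matrix (Fin d) (Fin d) ℂ) : ℝ :=
  (cfc Real.log (NormedSpace.exp ((-(1 / T)) • A) + 1)).trace.re

/-- The Fermi--Dirac operator `(exp(A / T) + I)⁻¹`. -/
noncomputable def fermiOp (T : ℝ) (A : Matrix (Fin d) (Fin d) ℂ) : Matrix (Fin d) (Fin d) ℂ :=
  (NormedSpace.exp ((1 / T) • A) + 1)⁻¹

variable {A M : Matrix (Fin d) (Fin d) ℂ}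

lemma exp_smul_add_one_eq_cfc (hA : A.IsHermitian) (r : ℝ) :
    NormedSpace.exp (r • A) + 1 = cfc (fun x => Real.exp (r * x) + 1) A := by
  rw [exp_smul_eq_cfc hA, cfc_add A _ _ (continuousOn_spectrum _ _) (continuousOn_spectrum _ _),
    cfc_const_one ℝ A hA.isSelfAdjoint]

lemma logPartition_eq_trace_cfc (T : ℝ) (hA : A.IsHermitian) :
    logPartition T A = (cfc (fun x => Real.log (Real.exp (-(x / T)) + 1)) A).trace.re := by
  rw [logPartition, exp_smul_add_one_eq_cfc hA, ← cfc_comp' Real.log _ A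
    (continuousOn_image_spectrum _ _ _) (continuousOn_spectrum _ _) hA.isSelfAdjoint]
  simp only [neg_mul, one_div_mul_eq_div]

lemma exp_add_one_mul_cfc (T : ℝ) (hA : A.IsHermitian) :
    (NormedSpace.exp ((1 / T) • A) + 1) * cfc (fun x => (Real.exp (x / T) + 1)⁻¹) A = 1 := by
  rw [exp_smul_add_one_eq_cfc hA,
    ← cfc_mul _ _ A (continuousOn_spectrum _ _) (continuousOn_spectrum _ _),
    ← cfc_const_one ℝ A hA.isSelfAdjoint]
  refine cfc_congr fun x _ => ?_
  have : 0 < Real.exp (x / T) + 1 := by positivity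
  rw [one_div_mul_eq_div, mul_inv_cancel₀ this.ne']

lemma fermiOp_eq_cfc (T : ℝ) (hA : A.IsHermitian) :
    fermiOp T A = cfc (fun x => (Real.exp (x / T) + 1)⁻¹) A :=
  Matrix.inv_eq_right_inv (exp_add_one_mul_cfc T hA)

lemma fermiOp_mem_measurementOps (T : ℝ) (hA : A.IsHermitian) :
    fermiOp T A ∈ measurementOps d := by
  rw [fermiOp_eq_cfc T hA]
  refine ⟨posSemidef_cfc hA fun x => by positivity, ?_⟩
  rw [← cfc_const_one ℝ A hA.isSelfAdjoint,
    ← cfc_sub _ _ A (continuousOn_spectrum _ _) (continuousOn_spectrum _ _)]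
  refine posSemidef_cfc hA fun x => sub_nonneg.2 (inv_le_one_of_one_le₀ ?_)
  linarith [Real.exp_pos (x / T)]

/-- Gibbs variational inequality. -/
lemma neg_logPartition_le {T : ℝ} (hT : 0 < T) (hA : A.IsHermitian)
    (hM : M ∈ measurementOps d) :
    -(T * logPartition T A) ≤ (A * M).trace.re - T * fdEntropy M := by
  have hMh := hM.1.isHermitian
  -- `A` and `M` need not commute. With shared overlap weights all three traces become double sums,
  -- and the scalar inequality at x = a/T applies termwise.
  obtain ⟨P, hP, key⟩ := exists_overlap_trace_cfc_mul_cfc hA hMh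
  have hA1 : cfc (fun _ : ℝ => (1 : ℝ)) A = 1 := cfc_const_one ℝ _ hA.isSelfAdjoint
  have hM1 : cfc (fun _ : ℝ => (1 : ℝ)) M = 1 := cfc_const_one ℝ _ hMh.isSelfAdjoint
  have e1 := key (fun x => x) (fun x => x)
  rw [cfc_id' ℝ A hA.isSelfAdjoint, cfc_id' ℝ M hMh.isSelfAdjoint] at e1
  have e2 := key (fun _ => 1) Real.binEntropy
  rw [hA1, one_mul, ← fdEntropy_eq_trace_cfc hMh] at e2
  have e3 := key (fun x => Real.log (Real.exp (-(x / T)) + 1)) (fun _ => 1)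
  rw [hM1, mul_one, ← logPartition_eq_trace_cfc T hA] at e3
  rw [e1, e2, e3, Finset.mul_sum, Finset.mul_sum, ← Finset.sum_neg_distrib,
    ← Finset.sum_sub_distrib]
  refine Finset.sum_le_sum fun i _ => ?_
  rw [Finset.mul_sum, Finset.mul_sum, ← Finset.sum_neg_distrib, ← Finset.sum_sub_distrib]
  refine Finset.sum_le_sum fun j _ => ?_
  have hm := spectrum_subset_Icc hM (hMh.eigenvalues_mem_spectrum_real j)
  set a := hA.eigenvalues i
  have h := mul_le_mul_of_nonneg_left (binEntropy_le_mul_add_log (a / T) hm.1 hm.2)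
    (mul_nonneg hT.le (hP i j))
  have hTa : T * (a / T) = a := mul_div_cancel₀ a hT.ne'
  set m := hMh.eigenvalues j
  have : T * P i j * (a / T * m + Real.log (Real.exp (-(a / T)) + 1)) =
      P i j * (a * m) + T * (P i j * Real.log (Real.exp (-(a / T)) + 1)) := by
    linear_combination P i j * m * hTa
  linarith

/-- The Fermi--Dirac operator attains equality in the Gibbs variational inequality. -/
lemma trace_mul_fermiOp_sub {T : ℝ} (hT : 0 < T) (hA : A.IsHermitian) :
    (A * fermiOp T A).trace.re - T * fdEntropy (fermiOp T A) = -(T * logPartition T A) := by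
  have hsa := hA.isSelfAdjoint
  set p : ℝ → ℝ := fun x => (Real.exp (x / T) + 1)⁻¹ with hp
  have hM := fermiOp_mem_measurementOps T hA
  rw [fdEntropy_eq_trace_cfc hM.1.isHermitian, fermiOp_eq_cfc T hA, ← hp,
    logPartition_eq_trace_cfc T hA, ← cfc_comp' Real.binEntropy p A
    (continuousOn_image_spectrum _ _ _) (continuousOn_spectrum _ _) hsa]
  have h1 : A * cfc p A = cfc (fun x => x * p x) A := by
    rw [cfc_mul (fun x => x) p A (continuousOn_spectrum _ _) (continuousOn_spectrum _ _),
      cfc_id' ℝ A hsa]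
  have h2 : (fun x => x * p x) = fun x => T * (Real.binEntropy (p x) -
      Real.log (Real.exp (-(x / T)) + 1)) := by
    funext x
    simp only [hp]
    rw [binEntropy_fermi]
    field_simp
    ring
  rw [h1, h2, cfc_const_mul T _ A (continuousOn_spectrum _ _),
    cfc_sub _ _ A (continuousOn_spectrum _ _) (continuousOn_spectrum _ _), trace_smul, trace_sub,
    Complex.real_smul, Complex.re_ofReal_mul, Complex.sub_re]
  ring

lemma continuousAt_fermiOp (T : ℝ) (hA : A.IsHermitian) : ContinuousAt (fermiOp T) A := by
  have hexp : Continuous (fun B : Matrix (Fin d) (Fin d) ℂ =>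
      NormedSpace.exp ((1 / T) • B) + 1) := by
    -- An auxiliary norm inducing the matrix topology, used only for continuity of the exponential.
    let : NormedRing (Matrix (Fin d) (Fin d) ℂ) := Matrix.linftyOpNormedRing
    let : NormedAlgebra ℂ (Matrix (Fin d) (Fin d) ℂ) := Matrix.linftyOpNormedAlgebra
    let : NormedAlgebra ℝ (Matrix (Fin d) (Fin d) ℂ) := Matrix.linftyOpNormedAlgebra
    let : NormedAlgebra ℚ (Matrix (Fin d) (Fin d) ℂ) := .restrictScalars ℚ ℝ _
    exact (NormedSpace.exp_continuous.comp (continuous_const_smul (1 / T))).add continuous_const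
  have hdet : (NormedSpace.exp ((1 / T) • A) + 1).det ≠ 0 := by
    intro h
    have := congrArg Matrix.det (exp_add_one_mul_cfc T hA)
    rw [det_mul, h, zero_mul, det_one] at this
    exact zero_ne_one this
  have : fermiOp T = fun B : Matrix (Fin d) (Fin d) ℂ =>
      (NormedSpace.exp ((1 / T) • B) + 1).det⁻¹ •
        (NormedSpace.exp ((1 / T) • B) + 1).adjugate := by
    funext B
    rw [fermiOp, Matrix.inv_def, Ring.inverse_eq_inv']
  rw [this]
  exact (hexp.matrix_det.continuousAt.inv₀ hdet).smul hexp.matrix_adjugate.continuousAt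

end Gibbs

/-! ### Lagrange duality and feasibility at a dual maximizer. -/

section Duality

variable {T : ℝ} {H M : Matrix (Fin d) (Fin d) ℂ} {Q : Fin c → Matrix (Fin d) (Fin d) ℂ}
  {q μ : Fin c → ℝ}

lemma isHermitian_real_smul {B : Matrix (Fin d) (Fin d) ℂ} (hB : B.IsHermitian) (r : ℝ) :
    (r • B).IsHermitian :=
  (IsSelfAdjoint.all r).smul hB.isSelfAdjoint

lemma isHermitian_shiftedHam (hH : H.IsHermitian) (hQ : ∀ i, (Q i).IsHermitian)
    (μ : Fin c → ℝ) : (shiftedHam H Q μ).IsHermitian :=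
  hH.sub (isSelfAdjoint_sum _ fun i _ => isHermitian_real_smul (hQ i) (μ i))

lemma dualObjective_eq (T : ℝ) (H : Matrix (Fin d) (Fin d) ℂ)
    (Q : Fin c → Matrix (Fin d) (Fin d) ℂ) (q μ : Fin c → ℝ) :
    dualObjective T H Q q μ = ∑ i, μ i * q i - T * logPartition T (shiftedHam H Q μ) := rfl

lemma thermalOp_eq (T : ℝ) (H : Matrix (Fin d) (Fin d) ℂ)
    (Q : Fin c → Matrix (Fin d) (Fin d) ℂ) (μ : Fin c → ℝ) :
    thermalOp T H Q μ = fermiOp T (shiftedHam H Q μ) := rfl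

lemma shiftedHam_update (H : Matrix (Fin d) (Fin d) ℂ) (Q : Fin c → Matrix (Fin d) (Fin d) ℂ)
    (μ : Fin c → ℝ) (i : Fin c) (t : ℝ) :
    shiftedHam H Q (μ + Pi.single i t) = shiftedHam H Q μ - t • Q i := by
  simp only [shiftedHam, Pi.add_apply, add_smul, Finset.sum_add_distrib, sub_sub]
  congr 2
  rw [Finset.sum_eq_single i (fun j _ hj => by rw [Pi.single_eq_of_ne hj, zero_smul])
    (fun h => absurd (Finset.mem_univ i) h), Pi.single_eq_same]

lemma sum_update_mul (q μ : Fin c → ℝ) (i : Fin c) (t : ℝ) :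
    ∑ j, (μ + Pi.single i t : Fin c → ℝ) j * q j = ∑ j, μ j * q j + t * q i := by
  simp only [Pi.add_apply, add_mul, Finset.sum_add_distrib]
  congr 1
  rw [Finset.sum_eq_single i (fun j _ hj => by rw [Pi.single_eq_of_ne hj, zero_mul])
    (fun h => absurd (Finset.mem_univ i) h), Pi.single_eq_same]

/-- Moving along a coordinate, the dual objective gains at least the constraint residual at the
displaced point, by concavity. -/
lemma mul_residual_nonpos (hT : 0 < T) (hH : H.IsHermitian) (hQ : ∀ i, (Q i).IsHermitian)
    (hμ : IsMaxOn (dualObjective T H Q q) Set.univ μ) (i : Fin c) (t : ℝ) :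
    t * (q i - (Q i * fermiOp T (shiftedHam H Q μ - t • Q i)).trace.re) ≤ 0 := by
  set A := shiftedHam H Q μ with hAdef
  have hA : A.IsHermitian := isHermitian_shiftedHam hH hQ μ
  have hB : (A - t • Q i).IsHermitian := hA.sub (isHermitian_real_smul (hQ i) t)
  have hmax : dualObjective T H Q q (μ + Pi.single i t) ≤ dualObjective T H Q q μ :=
    hμ (Set.mem_univ _)
  rw [dualObjective_eq, dualObjective_eq, shiftedHam_update, sum_update_mul, ← hAdef] at hmax
  -- The optimizer for the displaced Hamiltonian is a trial operator for the original one. This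
  -- bounds the dual increment below without differentiating a matrix function.
  have h1 := neg_logPartition_le hT hA (fermiOp_mem_measurementOps T hB)
  have h2 := trace_mul_fermiOp_sub hT hB
  rw [sub_mul, trace_sub, Complex.sub_re, smul_mul_assoc, trace_smul, Complex.real_smul,
    Complex.re_ofReal_mul] at h2
  linarith

/-- The residual at displacement t is ≤ 0 for t > 0 and ≥ 0 for t < 0; continuity of the Fermi
operator forces it to vanish at t = 0. -/
lemma thermalOp_mem_feasibleOps (hT : 0 < T) (hH : H.IsHermitian) (hQ : ∀ i, (Q i).IsHermitian)
    (hμ : IsMaxOn (dualObjective T H Q q) Set.univ μ) :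
    thermalOp T H Q μ ∈ feasibleOps Q q := by
  have hA := isHermitian_shiftedHam hH hQ μ
  have hM := fermiOp_mem_measurementOps T hA
  refine ⟨hM, fun i => ?_⟩
  rw [thermalOp_eq, ← trace_mul_ofReal_re (hQ i) hM.1.isHermitian]
  set φ : ℝ → ℝ := fun t => q i - (Q i * fermiOp T (shiftedHam H Q μ - t • Q i)).trace.re with hφ
  have hcont : ContinuousAt φ 0 := by
    have h0 : Tendsto (fun t : ℝ => shiftedHam H Q μ - t • Q i) (𝓝 0) (𝓝 (shiftedHam H Q μ)) := by
      have : Continuous (fun t : ℝ => shiftedHam H Q μ - t • Q i) := by fun_prop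
      simpa using this.tendsto 0
    have h1 := (continuousAt_fermiOp T hA).tendsto.comp h0
    have h2 : Continuous (fun N : Matrix (Fin d) (Fin d) ℂ => q i - (Q i * N).trace.re) :=
      continuous_const.sub (Complex.continuous_re.comp
        (continuous_const.matrix_mul continuous_id).matrix_trace)
    have h3 := (h2.tendsto _).comp h1
    rw [ContinuousAt]
    simpa [hφ, Function.comp_def] using h3
  have hres := mul_residual_nonpos hT hH hQ hμ i
  have hle : φ 0 ≤ 0 := by
    refine le_of_tendsto (hcont.tendsto.mono_left nhdsWithin_le_nhds : Tendsto φ (𝓝[>] 0) _) ?_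
    filter_upwards [self_mem_nhdsWithin] with t ht
    exact nonpos_of_mul_nonpos_right (hres t) ht
  have hge : 0 ≤ φ 0 := by
    refine ge_of_tendsto (hcont.tendsto.mono_left nhdsWithin_le_nhds : Tendsto φ (𝓝[<] 0) _) ?_
    filter_upwards [self_mem_nhdsWithin] with t ht
    have := hres t
    exact nonneg_of_mul_nonpos_right this ht
  have h0 : φ 0 = 0 := le_antisymm hle hge
  simp only [hφ, zero_smul, sub_zero] at h0
  exact_mod_cast (sub_eq_zero.1 h0).symm

/-- On feasible operators the Lagrange terms cancel, whatever μ is. -/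
lemma sum_add_trace_shiftedHam_mul (hM : M ∈ feasibleOps Q q) :
    ∑ i, μ i * q i + (shiftedHam H Q μ * M).trace.re = (H * M).trace.re := by
  have : ((∑ i, μ i • Q i) * M).trace.re = ∑ i, μ i * q i := by
    rw [Finset.sum_mul, trace_sum, Complex.re_sum]
    refine Finset.sum_congr rfl fun i _ => ?_
    rw [smul_mul_assoc, trace_smul, hM.2 i, Complex.real_smul, Complex.re_ofReal_mul,
      Complex.ofReal_re]
  rw [shiftedHam, sub_mul, trace_sub, Complex.sub_re, this]
  ring

/-- Weak duality. -/
lemma dualObjective_le (hT : 0 < T) (hH : H.IsHermitian) (hQ : ∀ i, (Q i).IsHermitian)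
    (hM : M ∈ feasibleOps Q q) :
    dualObjective T H Q q μ ≤ (H * M).trace.re - T * fdEntropy M := by
  have h := neg_logPartition_le hT (isHermitian_shiftedHam hH hQ μ) hM.1
  rw [dualObjective_eq, ← sum_add_trace_shiftedHam_mul (μ := μ) hM]
  linarith

/-- Strong duality at a thermal operator that is feasible. -/
lemma trace_mul_thermalOp_sub (hT : 0 < T) (hH : H.IsHermitian) (hQ : ∀ i, (Q i).IsHermitian)
    (hM : thermalOp T H Q μ ∈ feasibleOps Q q) :
    (H * thermalOp T H Q μ).trace.re - T * fdEntropy (thermalOp T H Q μ) =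
      dualObjective T H Q q μ := by
  have h := trace_mul_fermiOp_sub hT (isHermitian_shiftedHam hH hQ μ)
  rw [dualObjective_eq, ← sum_add_trace_shiftedHam_mul (μ := μ) hM, thermalOp_eq]
  linarith

end Duality

end FermiDirac

theorem mainTheorem6 (c d : ℕ) (hd : 0 < d)
    (H : Matrix (Fin d) (Fin d) ℂ) (hH : H.IsHermitian)
    (Q : Fin c → Matrix (Fin d) (Fin d) ℂ) (hQ : ∀ i, (Q i).IsHermitian)
    (q : Fin c → ℝ) (hfeas : (FermiDirac.feasibleOps Q q).Nonempty)
    (ε T : ℝ) (hε : 0 < ε) (hT : 0 < T)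
    (μ : Fin c → ℝ) (hμ : IsMaxOn (FermiDirac.dualObjective T H Q q) Set.univ μ)
    (hTε : T ≤ ε / (d * Real.log 2)) :
    FermiDirac.freeEnergy T H Q q = FermiDirac.dualObjective T H Q q μ ∧
      |FermiDirac.entropyFreeObjective T H Q q μ - FermiDirac.energy H Q q| ≤ ε := by
  have hM := FermiDirac.thermalOp_mem_feasibleOps hT hH hQ hμ
  have heq := FermiDirac.trace_mul_thermalOp_sub hT hH hQ hM
  have hlower {N} (hN : N ∈ FermiDirac.feasibleOps Q q) :
      FermiDirac.dualObjective T H Q q μ ≤ (H * N).trace.re := by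
    have h1 := FermiDirac.dualObjective_le (μ := μ) hT hH hQ hN
    have h2 := mul_nonneg hT.le (FermiDirac.fdEntropy_nonneg hN.1)
    linarith
  refine ⟨IsLeast.csInf_eq ⟨⟨_, hM, heq⟩, ?_⟩, ?_⟩
  · rintro _ ⟨N, hN, rfl⟩
    exact FermiDirac.dualObjective_le hT hH hQ hN
  have hent : T * FermiDirac.fdEntropy (FermiDirac.thermalOp T H Q μ) ≤ ε := by
    have hpos : 0 < (d : ℝ) * Real.log 2 :=
      mul_pos (Nat.cast_pos.2 hd) (Real.log_pos one_lt_two)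
    exact (mul_le_mul_of_nonneg_left (FermiDirac.fdEntropy_le hM.1) hT.le).trans
      ((le_div_iff₀ hpos).1 hTε)
  have hupper : FermiDirac.energy H Q q ≤ (H * FermiDirac.thermalOp T H Q μ).trace.re := by
    -- The real infimum needs a lower bound on the set; the dual value supplies it.
    refine csInf_le ⟨FermiDirac.dualObjective T H Q q μ, ?_⟩ ⟨_, hM, rfl⟩
    rintro _ ⟨N, hN, rfl⟩
    exact hlower hN
  have hge : FermiDirac.dualObjective T H Q q μ ≤ FermiDirac.energy H Q q := by
    refine le_csInf (hfeas.image _) ?_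
    rintro _ ⟨N, hN, rfl⟩
    exact hlower hN
  have hE : FermiDirac.entropyFreeObjective T H Q q μ =
      (H * FermiDirac.thermalOp T H Q μ).trace.re :=
    FermiDirac.sum_add_trace_shiftedHam_mul hM
  rw [hE, abs_le]
  -- 0 ≤ Tr[H M_T(μ)] - E ≤ Tr[H M_T(μ)] - f_T(μ) = T S_FD(M_T(μ)) ≤ ε.
  constructor <;> linarith
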